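/- Let $\{0,1\}^n$ be the set of binary words with coordinates indexed by $\{0,1,\dots,n-1\}$, equipped with the Hamming distance and with coordinatewise addition $+$ and multiplication $\cdot$ modulo $2$. A permutation $\sigma$ of the coordinates acts by $\sigma(x)=(x_{\sigma^{-1}(0)},\dots,x_{\sigma^{-1}(n-1)})$. A $Z_2Z_4$ structure is a permutation $\pi$ of $\{0,\dots,n-1\}$ with $\pi^2=\mathrm{Id}$ (fixed points, and $\pi=\mathrm{Id}$ itself, are allowed); it defines the operation $$x*_\pi y = x+y+(x+\pi(x))\cdot(y+\pi(y)).$$ A code $C\subseteq\{0,1\}^n$ is called $1$-perfect if $|C|=2^n/(n+1)$ and any two distinct codewords are at distance at least $3$; extended $1$-perfect if $|C|=2^{n-1}/n$ and any two distinct codewords are at distance at least $4$; and Preparata-like if $|C|=2^n/n^2$ and any two distinct codewords are at distance at least $6$. **Theorem.** Let $C$ be a $1$-perfect, extended $1$-perfect, or Preparata-like code of length $n>16$ that is closed with respect to both operations $*_\pi$ and $*_\tau$, where $\pi$ and $\tau$ are $Z_2Z_4$ structures. Then $\pi=\tau$. In other words, such a code admits at most one $Z_2Z_4$-linear structure. 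-/

import Mathlib

/-- The binary words of length `n`, with coordinates `0, 1, …, n - 1`; the pointwise `+` and `*`
are the coordinatewise addition and multiplication modulo 2. -/
abbrev BinWord (n : ℕ) : Type := Fin n → ZMod 2

/-- The action of a coordinate permutation: `σ(x) = (x_{σ⁻¹(0)}, …, x_{σ⁻¹(n-1)})`. -/
def permWord {n : ℕ} (σ : Equiv.Perm (Fin n)) (x : BinWord n) : BinWord n :=
  fun i => x (σ⁻¹ i)

/-- The operation `x *_π y = x + y + (x + π(x)) · (y + π(y))`. -/
def starOp {n : ℕ} (π : Equiv.Perm (Fin n)) (x y : BinWord n) : BinWord n :=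
  x + y + (x + permWord π x) * (y + permWord π y)

/-- A `Z₂Z₄` structure: an involution `π` of the coordinate set. Fixed points (self-adjacent
coordinates) are allowed, and so is the identity, which is the structure of linear codes. -/
def IsZ2Z4Structure {n : ℕ} (π : Equiv.Perm (Fin n)) : Prop :=
  Function.Involutive π

/-- `C` is closed with respect to the operation `*_π`. -/
def ClosedUnderStar {n : ℕ} (π : Equiv.Perm (Fin n)) (C : Set (BinWord n)) : Prop :=
  ∀ x ∈ C, ∀ y ∈ C, starOp π x y ∈ C

/-- Any two distinct codewords are at Hamming distance at least `d`. -/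
def HasMinDist {n : ℕ} (C : Set (BinWord n)) (d : ℕ) : Prop :=
  ∀ x ∈ C, ∀ y ∈ C, x ≠ y → d ≤ hammingDist x y

/-- A `1`-perfect code: cardinality `2 ^ n / (n + 1)` (an exact quotient, so written as a product)
and distance at least `3`. -/
def IsOnePerfect {n : ℕ} (C : Set (BinWord n)) : Prop :=
  C.ncard * (n + 1) = 2 ^ n ∧ HasMinDist C 3

/-- An extended `1`-perfect code: cardinality `2 ^ (n - 1) / n = 2 ^ n / (2 n)` (exact quotient)
and distance at least `4`. -/
def IsExtendedOnePerfect {n : ℕ} (C : Set (BinWord n)) : Prop :=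
  C.ncard * (2 * n) = 2 ^ n ∧ HasMinDist C 4

/-- A Preparata-like code: cardinality `2 ^ n / n ^ 2` (exact quotient) and distance at
least `6`. -/
def IsPreparataLike {n : ℕ} (C : Set (BinWord n)) : Prop :=
  C.ncard * n ^ 2 = 2 ^ n ∧ HasMinDist C 6

/-! Suppose `π` moves `i` and `π i ≠ τ i`. Take a light codeword `x` with `x i = 1` and `x (π i) =
0`, then a codeword `y` with `y i = 1` that vanishes at `π i` and, except at `i` itself, on the rest
of the support of `x` and on its images under `π` and `τ`. The product term of `x *_π y` is then the
indicator of `{i, π i}`, and that of `x *_τ y` is zero or the indicator of `{i, τ i}`. The two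
results are distinct codewords at distance at most 2, a contradiction (`apply_eq_of_light_words`).

It remains to find light codewords through `i` avoiding a given small set. Closure puts the zero
word in the code, so the light words form designs. In a 1-perfect code the words of weight 3 form a
Steiner triple system. An extended 1-perfect code is punctured at `i` to reduce to that case. A
punctured Preparata-like code has distance 5 and meets the Johnson bound; equality there makes the
weight-5 words through two points partition all other points but one into triples
(`exists_unique_uncovered_point`). In each case a forbidden point spoils at most one block through
the chosen points, so a block survives once the length is large enough. -/

open scoped symmDiff

/-! ### Codes as families of sets; Steiner triple systems of perfect codes -/

section SetCodes

variable {M : Type*} [DecidableEq M]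

theorem card_symmDiff_add_two_mul_card_inter (A B : Finset M) :
    (A ∆ B).card + 2 * (A ∩ B).card = A.card + B.card := by
  have h : A ∆ B = (A \ B) ∪ (B \ A) := rfl
  rw [h, Finset.card_union_of_disjoint (by
    rw [Finset.disjoint_left]; intro a; simp only [Finset.mem_sdiff]; tauto)]
  have h1 := Finset.card_sdiff_add_card_inter A B
  have h2 := Finset.card_sdiff_add_card_inter B A
  rw [Finset.inter_comm B A] at h2
  omega

theorem card_symmDiff_le_add (A B : Finset M) : (A ∆ B).card ≤ A.card + B.card := by
  have := card_symmDiff_add_two_mul_card_inter A B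
  omega

/-- Any two distinct sets of the family have a symmetric difference of size at least `d`. -/
def SetMinDist (𝒞 : Finset (Finset M)) (d : ℕ) : Prop :=
  ∀ A ∈ 𝒞, ∀ B ∈ 𝒞, A ≠ B → d ≤ (A ∆ B).card

theorem SetMinDist.eq_of_card_inter {𝒞 : Finset (Finset M)} {d : ℕ} (h : SetMinDist 𝒞 d)
    {A B : Finset M} (hA : A ∈ 𝒞) (hB : B ∈ 𝒞) {S : Finset M} (hSA : S ⊆ A) (hSB : S ⊆ B)
    (hc : A.card + B.card < d + 2 * S.card) : A = B := by
  by_contra hne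
  have h1 := h A hA B hB hne
  have h2 := card_symmDiff_add_two_mul_card_inter A B
  have h3 := Finset.card_le_card (Finset.subset_inter hSA hSB)
  omega

/-- The pairs formed by a member of a code and an error set of size at most `t` are
determined by the received set when the distance exceeds `2 t`. -/
theorem SetMinDist.injOn_symmDiff {𝒞 : Finset (Finset M)} {d t : ℕ} (h : SetMinDist 𝒞 d)
    (ht : 2 * t < d) (𝒮 : Finset (Finset M)) (h𝒮 : ∀ S ∈ 𝒮, S.card ≤ t) :
    Set.InjOn (fun x : Finset M × Finset M => x.1 ∆ x.2) (𝒞 ×ˢ 𝒮 : Finset _) := by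
  rintro ⟨A, S⟩ hx ⟨B, T⟩ hy heq
  simp only [Finset.coe_product, Set.mem_prod, Finset.mem_coe] at hx hy heq
  have hST : A ∆ B = S ∆ T := by
    have : B = A ∆ S ∆ T := by rw [heq, symmDiff_symmDiff_cancel_right]
    rw [this, symmDiff_assoc, symmDiff_symmDiff_cancel_left]
  have hAB : A = B := by
    by_contra hne
    have h1 := h A hx.1 B hy.1 hne
    have h2 := card_symmDiff_le_add S T
    have h3 := h𝒮 S hx.2
    have h4 := h𝒮 T hy.2
    rw [hST] at h1
    omega
  subst hAB
  rw [symmDiff_self] at hST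
  rw [symmDiff_eq_bot.mp hST.symm]

/-- The sizes already differ by at least `k`, so a symmetric difference of size at most `k` leaves
no room for points of `S` outside `A`. -/
theorem subset_of_card_symmDiff_le {A S : Finset M} {k : ℕ} (hA : S.card + k ≤ A.card)
    (h : (A ∆ S).card ≤ k) : S ⊆ A ∧ A.card = S.card + k := by
  have h1 := card_symmDiff_add_two_mul_card_inter A S
  have h2 : (A ∩ S).card ≤ S.card := Finset.card_le_card Finset.inter_subset_right
  refine ⟨?_, by omega⟩
  have h3 : A ∩ S = S := Finset.eq_of_subset_of_card_le Finset.inter_subset_right (by omega)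
  exact Finset.inter_eq_right.mp h3

variable [Fintype M]

/-- In a perfect one-error-correcting code through the origin, the words of weight three form a
Steiner triple system. -/
theorem exists_block_of_perfect {𝒞 : Finset (Finset M)} (h : SetMinDist 𝒞 3) (h0 : ∅ ∈ 𝒞)
    (hcard : 𝒞.card * (Fintype.card M + 1) = 2 ^ Fintype.card M) {p q : M} (hpq : p ≠ q) :
    ∃ A ∈ 𝒞, A.card = 3 ∧ p ∈ A ∧ q ∈ A := by
  classical
  let 𝒮 : Finset (Finset M) := insert ∅ (Finset.univ.image fun a => ({a} : Finset M))
  have h𝒮 : ∀ S ∈ 𝒮, S.card ≤ 1 := by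
    intro S hS
    simp only [𝒮, Finset.mem_insert, Finset.mem_image, Finset.mem_univ, true_and] at hS
    rcases hS with rfl | ⟨a, rfl⟩ <;> simp
  have h𝒮c : 𝒮.card = Fintype.card M + 1 := by
    rw [Finset.card_insert_of_notMem (by simp),
      Finset.card_image_of_injective _ Finset.singleton_injective, Finset.card_univ]
  -- The balls of radius one are disjoint and their sizes add up to the whole space, so they cover
  -- it.
  have himg : (𝒞 ×ˢ 𝒮).image (fun x => x.1 ∆ x.2) = Finset.univ := by
    rw [← Finset.card_eq_iff_eq_univ, Finset.card_image_of_injOn (h.injOn_symmDiff (by norm_num) 𝒮 h𝒮),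
      Finset.card_product, h𝒮c, hcard, Fintype.card_finset]
  have hmem : ({p, q} : Finset M) ∈ (𝒞 ×ˢ 𝒮).image (fun x => x.1 ∆ x.2) := by simp [himg]
  simp only [Finset.mem_image, Finset.mem_product, Prod.exists] at hmem
  obtain ⟨A, S, ⟨hA, hS⟩, hAS⟩ := hmem
  have hdist : (A ∆ {p, q}).card ≤ 1 := by
    rw [← hAS, symmDiff_symmDiff_cancel_left]; exact h𝒮 S hS
  have hA0 : A ≠ ∅ := by
    rintro rfl
    have hb : (∅ : Finset M) = ⊥ := rfl
    rw [hb, bot_symmDiff, Finset.card_pair hpq] at hdist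
    omega
  have hA3 : 3 ≤ A.card := by
    have := h A hA ∅ h0 hA0
    rwa [show (∅ : Finset M) = ⊥ from rfl, symmDiff_bot] at this
  have := subset_of_card_symmDiff_le (k := 1) (by rw [Finset.card_pair hpq]; omega) hdist
  rw [Finset.card_pair hpq] at this
  exact ⟨A, hA, this.2, this.1 (by simp), this.1 (by simp)⟩

/-- If every point outside a small set `E` lies in a block through `P`, and blocks through `P`
sharing a further point coincide, then some block through `P` avoids a given small set. -/
theorem exists_block_disjoint {ℬ : Finset (Finset M)} {P E F : Finset M} {k : ℕ}
    (hPF : Disjoint P F) (hℬ : ∀ A ∈ ℬ, P ⊆ A ∧ (A \ P).card ≤ k)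
    (huniq : ∀ A ∈ ℬ, ∀ B ∈ ℬ, ∀ r ∉ P, r ∈ A → r ∈ B → A = B)
    (hcover : ∀ r ∉ E, ∃ A ∈ ℬ, r ∈ A) (hPE : P ⊆ E)
    (hcard : E.card + F.card * k < Fintype.card M) : ∃ A ∈ ℬ, Disjoint A F := by
  classical
  -- `g f` is what a forbidden point `f` spoils: the part outside `P` of the block through `f`, or
  -- nothing if no block contains `f`. A point `r` outside `E` and all `g f` lies in a good block.
  let g : M → Finset M := fun f => if hf : ∃ A ∈ ℬ, f ∈ A then hf.choose \ P else ∅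
  have hg : ∀ f, (g f).card ≤ k := by
    intro f
    by_cases hf : ∃ A ∈ ℬ, f ∈ A
    · simp only [g, hf, dif_pos]; exact (hℬ _ hf.choose_spec.1).2
    · simp [g, hf]
  have hbad : (E ∪ F.biUnion g).card < Fintype.card M := by
    have h1 := Finset.card_union_le E (F.biUnion g)
    have h2 := Finset.card_biUnion_le_card_mul F g k (fun f _ => hg f)
    omega
  obtain ⟨r, hr⟩ : ∃ r, r ∉ E ∪ F.biUnion g := by
    by_contra! hall
    rw [Finset.eq_univ_of_forall hall, Finset.card_univ] at hbad
    exact lt_irrefl _ hbad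
  rw [Finset.mem_union, not_or] at hr
  obtain ⟨A, hA, hrA⟩ := hcover r hr.1
  refine ⟨A, hA, Finset.disjoint_left.mpr fun f hfA hfF => hr.2 ?_⟩
  have hf : ∃ A ∈ ℬ, f ∈ A := ⟨A, hA, hfA⟩
  have hfP : f ∉ P := fun hfP => Finset.disjoint_left.mp hPF hfP hfF
  have hAe : hf.choose = A := huniq _ hf.choose_spec.1 _ hA f hfP hf.choose_spec.2 hfA
  refine Finset.mem_biUnion.mpr ⟨f, hfF, ?_⟩
  simp only [g, hf, dif_pos, hAe, Finset.mem_sdiff]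
  exact ⟨hrA, fun h => hr.1 (hPE h)⟩

theorem exists_triple_disjoint_of_perfect {𝒞 : Finset (Finset M)} (h : SetMinDist 𝒞 3)
    (h0 : ∅ ∈ 𝒞) (hcard : 𝒞.card * (Fintype.card M + 1) = 2 ^ Fintype.card M) {p : M}
    {F : Finset M} (hpF : p ∉ F) (hF : 1 + F.card * 2 < Fintype.card M) :
    ∃ A ∈ 𝒞, A.card = 3 ∧ p ∈ A ∧ Disjoint A F := by
  classical
  obtain ⟨A, hA, hAF⟩ := exists_block_disjoint (ℬ := 𝒞.filter fun A => A.card = 3 ∧ p ∈ A)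
    (P := {p}) (E := {p}) (F := F) (k := 2) (by simpa using hpF)
    (by
      intro A hA
      simp only [Finset.mem_filter] at hA
      refine ⟨by simpa using hA.2.2, ?_⟩
      rw [Finset.card_sdiff_of_subset (by simpa using hA.2.2)]
      simp [hA.2.1])
    (by
      intro A hA B hB r hr hrA hrB
      simp only [Finset.mem_filter] at hA hB
      refine h.eq_of_card_inter hA.1 hB.1 (S := {p, r}) ?_ ?_ ?_
      · simp [Finset.insert_subset_iff, hA.2.2, hrA]
      · simp [Finset.insert_subset_iff, hB.2.2, hrB]
      · rw [Finset.card_pair (by rintro rfl; simp at hr)]; omega)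
    (by
      intro r hr
      obtain ⟨A, hA, h3, hp, hq⟩ := exists_block_of_perfect h h0 hcard
        (p := p) (q := r) (by rintro rfl; simp at hr)
      exact ⟨A, by simp [hA, h3, hp], hq⟩)
    subset_rfl (by simpa using hF)
  simp only [Finset.mem_filter] at hA
  exact ⟨A, hA.1, hA.2.1, hA.2.2, hAF⟩

end SetCodes

/-! ### Distance-five codes and equality in the Johnson bound -/

section NearlyPerfect

variable {M : Type*} [DecidableEq M] [Fintype M]

/-- In a code of distance five through the origin, the points that complete `p, q` to a triple
inside a word of weight five come in groups of three. -/
theorem three_dvd_card_covered {𝒞 : Finset (Finset M)} (h : SetMinDist 𝒞 5) {p q : M}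
    (hpq : p ≠ q) :
    3 ∣ (Finset.univ.filter fun r => r ≠ p ∧ r ≠ q ∧
      ∃ A ∈ 𝒞, A.card = 5 ∧ p ∈ A ∧ q ∈ A ∧ r ∈ A).card := by
  classical
  have heq : (Finset.univ.filter fun r => r ≠ p ∧ r ≠ q ∧
      ∃ A ∈ 𝒞, A.card = 5 ∧ p ∈ A ∧ q ∈ A ∧ r ∈ A) =
      (𝒞.filter fun A => A.card = 5 ∧ p ∈ A ∧ q ∈ A).biUnion fun A => A \ {p, q} := by
    ext r
    simp only [Finset.mem_filter, Finset.mem_univ, true_and, Finset.mem_biUnion,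
      Finset.mem_sdiff, Finset.mem_insert, Finset.mem_singleton, not_or]
    constructor
    · rintro ⟨h1, h2, A, hA, h5, hp, hq, hr⟩
      exact ⟨A, ⟨hA, h5, hp, hq⟩, hr, h1, h2⟩
    · rintro ⟨A, ⟨hA, h5, hp, hq⟩, hr, h1, h2⟩
      exact ⟨h1, h2, A, hA, h5, hp, hq, hr⟩
  rw [heq, Finset.card_biUnion]
  · refine Finset.dvd_sum fun A hA => ?_
    simp only [Finset.mem_filter] at hA
    rw [Finset.card_sdiff_of_subset (by simp [Finset.insert_subset_iff, hA.2.2.1, hA.2.2.2]),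
      Finset.card_pair hpq, hA.2.1]
  · intro A hA B hB hAB
    simp only [Finset.mem_coe, Finset.mem_filter] at hA hB
    rw [Function.onFun, Finset.disjoint_left]
    intro r hrA hrB
    simp only [Finset.mem_sdiff, Finset.mem_insert, Finset.mem_singleton, not_or] at hrA hrB
    refine hAB (h.eq_of_card_inter hA.1 hB.1 (S := {p, q, r}) ?_ ?_ ?_)
    · simp [Finset.insert_subset_iff, hA.2.2.1, hA.2.2.2, hrA.1]
    · simp [Finset.insert_subset_iff, hB.2.2.1, hB.2.2.2, hrB.1]
    · rw [Finset.card_eq_three.mpr ⟨p, q, r, hpq, Ne.symm hrA.2.1, Ne.symm hrA.2.2, rfl⟩]; omega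

/-- The words at distance more than two from the code. -/
def uncovered (𝒞 : Finset (Finset M)) : Finset (Finset M) :=
  Finset.univ.filter fun v => ∀ c ∈ 𝒞, 2 < (c ∆ v).card

/-- The error sets of size three leading from `c` to a word far from the code. -/
def uncoveredTriples (𝒞 : Finset (Finset M)) (c : Finset M) : Finset (Finset M) :=
  (Finset.univ.powersetCard 3).filter fun S => c ∆ S ∈ uncovered 𝒞

/-- A codeword within distance 2 of a triple is not the origin, so it has weight at least 5;
closeness then forces weight exactly 5 and containment. -/
theorem exists_block_of_covered_triple {𝒞 : Finset (Finset M)} (h : SetMinDist 𝒞 5)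
    (h0 : ∅ ∈ 𝒞) {S : Finset M} (hS : S.card = 3) (hc : S ∉ uncoveredTriples 𝒞 ∅) :
    ∃ A ∈ 𝒞, A.card = 5 ∧ S ⊆ A := by
  have hb : (∅ : Finset M) = ⊥ := rfl
  have hc' : ¬ ∀ c ∈ 𝒞, 2 < (c ∆ S).card := by
    intro hh
    apply hc
    simp only [uncoveredTriples, uncovered, Finset.mem_filter, Finset.mem_powersetCard_univ,
      Finset.mem_univ, true_and, hb, bot_symmDiff]
    exact ⟨hS, hh⟩
  push Not at hc'
  obtain ⟨A, hA, hAS⟩ := hc'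
  have hA0 : A ≠ ∅ := by
    rintro rfl
    rw [hb, bot_symmDiff] at hAS
    omega
  have hA5 := h A hA ∅ h0 hA0
  rw [hb, symmDiff_bot] at hA5
  have := subset_of_card_symmDiff_le (k := 2) (by omega) hAS
  exact ⟨A, hA, by omega, this.1⟩

/-- Translation of a code by `c`. -/
theorem SetMinDist.translate {𝒞 : Finset (Finset M)} {d : ℕ} (h : SetMinDist 𝒞 d)
    (c : Finset M) : SetMinDist (𝒞.image (c ∆ ·)) d := by
  intro A hA B hB hAB
  obtain ⟨a, ha, rfl⟩ := Finset.mem_image.mp hA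
  obtain ⟨b, hb, rfl⟩ := Finset.mem_image.mp hB
  have : (c ∆ a) ∆ (c ∆ b) = a ∆ b := by
    rw [symmDiff_comm c a, symmDiff_assoc, symmDiff_symmDiff_cancel_left]
  rw [this]
  exact h a ha b hb (by rintro rfl; exact hAB rfl)

theorem uncoveredTriples_translate (𝒞 : Finset (Finset M)) (c : Finset M) :
    uncoveredTriples (𝒞.image (c ∆ ·)) ∅ = uncoveredTriples 𝒞 c := by
  have hb : (∅ : Finset M) = ⊥ := rfl
  ext S
  simp only [uncoveredTriples, uncovered, Finset.mem_filter, Finset.mem_univ, true_and, hb,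
    bot_symmDiff, Finset.forall_mem_image]
  refine and_congr_right fun _ => forall₂_congr fun a _ => ?_
  rw [symmDiff_comm c a, symmDiff_assoc]

/-- Translate `c` to the origin. If every triple through the pair were covered, the weight-5 words
through it would partition the other points into triples, which `hmod` forbids. -/
theorem exists_uncoveredTriple_of_pair {𝒞 : Finset (Finset M)} (h : SetMinDist 𝒞 5)
    (hM : 2 ≤ Fintype.card M) (hmod : Fintype.card M % 3 ≠ 2) {c : Finset M} (hc : c ∈ 𝒞)
    {P : Finset M} (hP : P.card = 2) : ∃ S ∈ uncoveredTriples 𝒞 c, P ⊆ S := by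
  classical
  rw [← uncoveredTriples_translate]
  have h' := h.translate c
  have h0 : ∅ ∈ 𝒞.image (c ∆ ·) := Finset.mem_image.mpr ⟨c, hc, symmDiff_self c⟩
  obtain ⟨p, q, hpq, rfl⟩ := Finset.card_eq_two.mp hP
  by_contra! hcon
  have hdvd := three_dvd_card_covered h' hpq
  have heq : (Finset.univ.filter fun r => r ≠ p ∧ r ≠ q ∧
      ∃ A ∈ 𝒞.image (c ∆ ·), A.card = 5 ∧ p ∈ A ∧ q ∈ A ∧ r ∈ A) = Finset.univ \ {p, q} := by
    ext r
    simp only [Finset.mem_filter, Finset.mem_univ, true_and, Finset.mem_sdiff,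
      Finset.mem_insert, Finset.mem_singleton, not_or]
    refine ⟨fun hr => ⟨hr.1, hr.2.1⟩, fun hr => ⟨hr.1, hr.2, ?_⟩⟩
    have h3 : ({p, q, r} : Finset M).card = 3 :=
      Finset.card_eq_three.mpr ⟨p, q, r, hpq, Ne.symm hr.1, Ne.symm hr.2, rfl⟩
    obtain ⟨A, hA, hA5, hSA⟩ := exists_block_of_covered_triple h' h0 h3
      (fun hS => hcon _ hS (by simp [Finset.insert_subset_iff]))
    exact ⟨A, hA, hA5, hSA (by simp), hSA (by simp), hSA (by simp)⟩
  rw [heq, Finset.card_sdiff_of_subset (Finset.subset_univ _), Finset.card_univ,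
    Finset.card_pair hpq] at hdvd
  omega

theorem three_mul_card_eq_sum_pairs (𝒯 : Finset (Finset M)) (h𝒯 : ∀ S ∈ 𝒯, S.card = 3) :
    3 * 𝒯.card = ∑ P ∈ Finset.univ.powersetCard 2, (𝒯.filter fun S => P ⊆ S).card := by
  have := Finset.sum_card_bipartiteAbove_eq_sum_card_bipartiteBelow
    (s := (Finset.univ : Finset M).powersetCard 2) (t := 𝒯) (fun P S => P ⊆ S)
  simp only [Finset.bipartiteAbove, Finset.bipartiteBelow] at this
  rw [this, Finset.sum_congr rfl (g := fun _ => 3), Finset.sum_const, smul_eq_mul, mul_comm]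
  intro S hS
  have : (Finset.powersetCard 2 Finset.univ).filter (fun P => P ⊆ S) = S.powersetCard 2 := by
    ext P; simp [Finset.mem_powersetCard, and_comm]
  rw [this, Finset.card_powersetCard, h𝒯 S hS]
  rfl

theorem card_sets_card_le_two :
    2 * (Finset.univ.filter fun S : Finset M => S.card ≤ 2).card =
      Fintype.card M ^ 2 + Fintype.card M + 2 := by
  classical
  have h : (Finset.univ.filter fun S : Finset M => S.card ≤ 2) =
      (Finset.range 3).biUnion fun k => Finset.univ.powersetCard k := by
    ext S
    simp
    omega
  rw [h, Finset.card_biUnion (fun i _ j _ hij => by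
    exact Finset.pairwise_disjoint_powersetCard _ hij)]
  simp only [Finset.card_powersetCard, Finset.card_univ, Finset.sum_range_succ,
    Finset.sum_range_zero, Nat.choose_zero_right, Nat.choose_one_right]
  have := Nat.choose_two_right (Fintype.card M)
  have h2 := Nat.div_mul_cancel (Nat.even_mul_pred_self (Fintype.card M)).two_dvd
  rw [← this] at h2
  rcases hN : Fintype.card M with _ | N
  · simp
  · rw [hN] at h2
    simp only [Nat.add_sub_cancel] at h2
    nlinarith

/-- Distance 5 makes the balls of radius 2 disjoint; the count is doubled to avoid dividing. -/
theorem card_uncovered {𝒞 : Finset (Finset M)} (h : SetMinDist 𝒞 5) :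
    2 * (uncovered 𝒞).card + 𝒞.card * (Fintype.card M ^ 2 + Fintype.card M + 2) =
      2 ^ (Fintype.card M + 1) := by
  classical
  have himg : (𝒞 ×ˢ Finset.univ.filter fun S : Finset M => S.card ≤ 2).image
      (fun x => x.1 ∆ x.2) = (uncovered 𝒞)ᶜ := by
    ext v
    simp only [uncovered, Finset.mem_image, Finset.mem_product, Finset.mem_filter,
      Finset.mem_univ, true_and, Prod.exists, Finset.mem_compl, not_forall, not_lt]
    constructor
    · rintro ⟨c, S, ⟨hc, hS⟩, rfl⟩
      exact ⟨c, hc, by rwa [symmDiff_symmDiff_cancel_left]⟩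
    · rintro ⟨c, hc, hS⟩
      exact ⟨c, c ∆ v, ⟨hc, hS⟩, symmDiff_symmDiff_cancel_left _ _⟩
  have h1 := Finset.card_image_of_injOn (h.injOn_symmDiff (t := 2) (by norm_num)
    (Finset.univ.filter fun S : Finset M => S.card ≤ 2) (by simp))
  rw [himg, Finset.card_product] at h1
  have h2 := Finset.card_add_card_compl (uncovered 𝒞)
  rw [h1, Fintype.card_finset] at h2
  rw [← card_sets_card_le_two, pow_succ, ← h2]
  ring

/-- Double count pairs of a codeword and an uncovered word `v` at distance 3. For fixed `v` the
error triples `c ∆ v` are pairwise disjoint, since two that meet would give codewords at distance at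
most 4. -/
theorem sum_card_uncoveredTriples_le {𝒞 : Finset (Finset M)} (h : SetMinDist 𝒞 5) :
    ∑ c ∈ 𝒞, 3 * (uncoveredTriples 𝒞 c).card ≤ (uncovered 𝒞).card * Fintype.card M := by
  classical
  have h1 : ∀ c ∈ 𝒞, (uncoveredTriples 𝒞 c).card =
      ((uncovered 𝒞).filter fun v => (c ∆ v).card = 3).card := by
    intro c _
    refine Finset.card_nbij' (fun S => c ∆ S) (fun v => c ∆ v) ?_ ?_ ?_ ?_
    · intro S hS
      simp only [uncoveredTriples, Finset.coe_filter, Set.mem_ofPred_eq,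
        Finset.mem_powersetCard_univ] at hS ⊢
      rw [symmDiff_symmDiff_cancel_left]
      exact ⟨hS.2, hS.1⟩
    · intro v hv
      simp only [uncoveredTriples, Finset.coe_filter, Set.mem_ofPred_eq,
        Finset.mem_powersetCard_univ] at hv ⊢
      rw [symmDiff_symmDiff_cancel_left]
      exact ⟨hv.2, hv.1⟩
    · intro S _; exact symmDiff_symmDiff_cancel_left _ _
    · intro S _; exact symmDiff_symmDiff_cancel_left _ _
  have h2 := Finset.sum_card_bipartiteAbove_eq_sum_card_bipartiteBelow
    (s := 𝒞) (t := uncovered 𝒞) (fun c v => (c ∆ v).card = 3)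
  simp only [Finset.bipartiteAbove, Finset.bipartiteBelow] at h2
  rw [← Finset.mul_sum, Finset.sum_congr rfl h1, h2, Finset.mul_sum]
  refine (Finset.sum_le_card_nsmul _ _ (Fintype.card M) fun v _ => ?_).trans_eq (by simp)
  have hdisj : ((𝒞.filter fun c => (c ∆ v).card = 3).biUnion fun c => c ∆ v).card =
      ∑ c ∈ 𝒞.filter fun c => (c ∆ v).card = 3, (c ∆ v).card := by
    refine Finset.card_biUnion fun a ha b hb hab => ?_
    simp only [Finset.mem_coe, Finset.mem_filter] at ha hb
    have hd := h a ha.1 b hb.1 hab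
    have he : a ∆ b = (a ∆ v) ∆ (b ∆ v) := by
      rw [symmDiff_comm b v, symmDiff_assoc, symmDiff_symmDiff_cancel_left]
    have := card_symmDiff_add_two_mul_card_inter (a ∆ v) (b ∆ v)
    rw [← he] at this
    rw [Function.onFun, Finset.disjoint_iff_inter_eq_empty, ← Finset.card_eq_zero]
    omega
  rw [Finset.sum_congr rfl (g := fun _ => 3) (fun c hc => (Finset.mem_filter.mp hc).2),
    Finset.sum_const, smul_eq_mul, mul_comm] at hdisj
  rw [← hdisj]
  exact Finset.card_le_univ _

/-- In a code meeting the Johnson bound, every pair lies in exactly one triple that is not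
contained in a word of weight five. -/
theorem card_uncoveredTriples_of_pair {𝒞 : Finset (Finset M)} (h : SetMinDist 𝒞 5)
    (h0 : ∅ ∈ 𝒞) (hM : 2 ≤ Fintype.card M) (hmod : Fintype.card M % 3 ≠ 2)
    (hcard : 𝒞.card * (Fintype.card M + 1) ^ 2 = 2 ^ (Fintype.card M + 1))
    {P : Finset M} (hP : P.card = 2) :
    ((uncoveredTriples 𝒞 ∅).filter fun S => P ⊆ S).card = 1 := by
  classical
  have h3 : ∀ c, ∀ S ∈ uncoveredTriples 𝒞 c, S.card = 3 := by
    intro c S hS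
    simp only [uncoveredTriples, Finset.mem_filter, Finset.mem_powersetCard_univ] at hS
    exact hS.1
  have hge1 : ∀ c ∈ 𝒞, ∀ Q ∈ (Finset.univ : Finset M).powersetCard 2,
      1 ≤ ((uncoveredTriples 𝒞 c).filter fun S => Q ⊆ S).card := by
    intro c hc Q hQ
    obtain ⟨S, hS, hQS⟩ := exists_uncoveredTriple_of_pair h hM hmod hc
      (Finset.mem_powersetCard_univ.mp hQ)
    exact Finset.card_pos.mpr ⟨S, Finset.mem_filter.mpr ⟨hS, hQS⟩⟩
  let m := ((Finset.univ : Finset M).powersetCard 2).card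
  have hm : 2 * m = Fintype.card M * (Fintype.card M - 1) := by
    simp only [m, Finset.card_powersetCard, Finset.card_univ, Nat.choose_two_right]
    exact Nat.mul_div_cancel' (Nat.even_mul_pred_self _).two_dvd
  have hlow : ∀ c ∈ 𝒞, m ≤ 3 * (uncoveredTriples 𝒞 c).card := by
    intro c hc
    rw [three_mul_card_eq_sum_pairs _ (h3 c)]
    simpa [m] using Finset.card_nsmul_le_sum _ _ 1 (hge1 c hc)
  -- With `N + 1` coordinates, `hcard` gives `2 * (uncovered 𝒞).card = 𝒞.card * N`. The upper bound
  -- from double counting thus equals the sum of the lower bounds `m`, so equality holds at every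
  -- codeword and every pair.
  have hsum : ∑ c ∈ 𝒞, 3 * (uncoveredTriples 𝒞 c).card ≤ ∑ c ∈ 𝒞, m := by
    refine (sum_card_uncoveredTriples_le h).trans ?_
    rw [Finset.sum_const, smul_eq_mul]
    have h1 := card_uncovered h
    rw [← hcard] at h1
    obtain ⟨N, hN⟩ : ∃ N, Fintype.card M = N + 1 := ⟨Fintype.card M - 1, by omega⟩
    rw [hN] at h1 hm ⊢
    simp only [Nat.add_sub_cancel] at hm
    have h2 : 2 * (uncovered 𝒞).card = 𝒞.card * N := by nlinarith
    have h4 : 2 * ((uncovered 𝒞).card * (N + 1)) = 2 * (𝒞.card * m) := by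
      calc _ = (2 * (uncovered 𝒞).card) * (N + 1) := by ring
        _ = 𝒞.card * (2 * m) := by rw [h2, hm]; ring
        _ = _ := by ring
    omega
  have heq := (Finset.sum_eq_sum_iff_of_le hlow).mp (le_antisymm (Finset.sum_le_sum hlow) hsum)
    ∅ h0
  rw [three_mul_card_eq_sum_pairs _ (h3 ∅)] at heq
  have hm1 : m = ∑ Q ∈ (Finset.univ : Finset M).powersetCard 2, 1 := by simp [m]
  rw [hm1] at heq
  exact ((Finset.sum_eq_sum_iff_of_le (hge1 ∅ h0)).mp heq P
    (Finset.mem_powersetCard_univ.mpr hP)).symm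

theorem exists_unique_uncovered_point {𝒞 : Finset (Finset M)} (h : SetMinDist 𝒞 5)
    (h0 : ∅ ∈ 𝒞) (hM : 2 ≤ Fintype.card M) (hmod : Fintype.card M % 3 ≠ 2)
    (hcard : 𝒞.card * (Fintype.card M + 1) ^ 2 = 2 ^ (Fintype.card M + 1))
    {p q : M} (hpq : p ≠ q) :
    ∃ s, s ≠ p ∧ s ≠ q ∧ (¬ ∃ A ∈ 𝒞, A.card = 5 ∧ p ∈ A ∧ q ∈ A ∧ s ∈ A) ∧
      ∀ r, r ≠ p → r ≠ q → r ≠ s → ∃ A ∈ 𝒞, A.card = 5 ∧ p ∈ A ∧ q ∈ A ∧ r ∈ A := by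
  classical
  obtain ⟨S, hS⟩ := Finset.card_eq_one.mp
    (card_uncoveredTriples_of_pair h h0 hM hmod hcard (Finset.card_pair hpq))
  have hmem : ∀ T, (T ∈ uncoveredTriples 𝒞 ∅ ∧ {p, q} ⊆ T) ↔ T = S := by
    intro T
    rw [← Finset.mem_filter, hS, Finset.mem_singleton]
  obtain ⟨hSu, hSpq⟩ := (hmem S).mpr rfl
  have hS3 : S.card = 3 := by
    simp only [uncoveredTriples, Finset.mem_filter, Finset.mem_powersetCard_univ] at hSu
    exact hSu.1
  obtain ⟨s, hs⟩ : ∃ s, s ∈ S \ {p, q} := by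
    rw [← Finset.Nonempty, ← Finset.card_pos, Finset.card_sdiff_of_subset hSpq, hS3,
      Finset.card_pair hpq]
    norm_num
  simp only [Finset.mem_sdiff, Finset.mem_insert, Finset.mem_singleton, not_or] at hs
  have hSeq : ({p, q, s} : Finset M) = S := by
    refine Finset.eq_of_subset_of_card_le ?_ ?_
    · rw [Finset.insert_subset_iff] at hSpq
      simp only [Finset.insert_subset_iff, Finset.singleton_subset_iff]
      exact ⟨hSpq.1, Finset.singleton_subset_iff.mp hSpq.2, hs.1⟩
    · rw [hS3, Finset.card_eq_three.mpr ⟨p, q, s, hpq, Ne.symm hs.2.1, Ne.symm hs.2.2, rfl⟩]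
  refine ⟨s, hs.2.1, hs.2.2, ?_, ?_⟩
  · rintro ⟨A, hA, hA5, hp, hq, hsA⟩
    have hSA : S ⊆ A := by
      rw [← hSeq]; simp [Finset.insert_subset_iff, hp, hq, hsA]
    simp only [uncoveredTriples, uncovered, Finset.mem_filter, Finset.mem_univ, true_and,
      show (∅ : Finset M) = ⊥ from rfl, bot_symmDiff] at hSu
    have h1 := hSu.2 A hA
    have h2 := card_symmDiff_add_two_mul_card_inter A S
    rw [Finset.inter_eq_right.mpr hSA] at h2
    omega
  · intro r hrp hrq hrs
    have h3 : ({p, q, r} : Finset M).card = 3 :=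
      Finset.card_eq_three.mpr ⟨p, q, r, hpq, Ne.symm hrp, Ne.symm hrq, rfl⟩
    obtain ⟨A, hA, hA5, hSA⟩ := exists_block_of_covered_triple h h0 h3 (fun hu => by
      have := (hmem _).mp ⟨hu, by simp [Finset.insert_subset_iff]⟩
      rw [← hSeq] at this
      have hr : r ∈ ({p, q, s} : Finset M) := this ▸ (by simp)
      simp [hrp, hrq, hrs] at hr)
    exact ⟨A, hA, hA5, hSA (by simp), hSA (by simp), hSA (by simp)⟩

/-- The weight-5 words through `p, q` partition the points other than `p, q, s` into triples. This
is what rules out Preparata-like codes of length 32. -/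
theorem card_mod_three_of_nearly_perfect {𝒞 : Finset (Finset M)} (h : SetMinDist 𝒞 5)
    (h0 : ∅ ∈ 𝒞) (hM : 2 ≤ Fintype.card M) (hmod : Fintype.card M % 3 ≠ 2)
    (hcard : 𝒞.card * (Fintype.card M + 1) ^ 2 = 2 ^ (Fintype.card M + 1)) :
    3 ∣ Fintype.card M := by
  classical
  obtain ⟨p, q, hpq⟩ := Fintype.exists_pair_of_one_lt_card (α := M) (by omega)
  obtain ⟨s, hsp, hsq, hs, hr⟩ := exists_unique_uncovered_point h h0 hM hmod hcard hpq
  have hdvd := three_dvd_card_covered h hpq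
  have heq : (Finset.univ.filter fun r => r ≠ p ∧ r ≠ q ∧
      ∃ A ∈ 𝒞, A.card = 5 ∧ p ∈ A ∧ q ∈ A ∧ r ∈ A) = Finset.univ \ {p, q, s} := by
    ext r
    simp only [Finset.mem_filter, Finset.mem_univ, true_and, Finset.mem_sdiff,
      Finset.mem_insert, Finset.mem_singleton, not_or]
    constructor
    · rintro ⟨h1, h2, h3⟩
      exact ⟨h1, h2, by rintro rfl; exact hs h3⟩
    · rintro ⟨h1, h2, h3⟩
      exact ⟨h1, h2, hr r h1 h2 h3⟩
  have h3 : ({p, q, s} : Finset M).card = 3 :=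
    Finset.card_eq_three.mpr ⟨p, q, s, hpq, hsp.symm, hsq.symm, rfl⟩
  have hle := Finset.card_le_univ ({p, q, s} : Finset M)
  rw [heq, Finset.card_sdiff_of_subset (Finset.subset_univ _), Finset.card_univ, h3] at hdvd
  omega

theorem exists_quintuple_disjoint_of_nearly_perfect {𝒞 : Finset (Finset M)}
    (h : SetMinDist 𝒞 5) (h0 : ∅ ∈ 𝒞) (hmod : Fintype.card M % 3 ≠ 2)
    (hcard : 𝒞.card * (Fintype.card M + 1) ^ 2 = 2 ^ (Fintype.card M + 1))
    {F : Finset M} (hF : 3 + F.card * 3 < Fintype.card M) :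
    ∃ A ∈ 𝒞, A.card = 5 ∧ Disjoint A F := by
  classical
  obtain ⟨p, hp, q, hq, hpq⟩ := Finset.one_lt_card.mp
    (show 1 < Fᶜ.card by rw [Finset.card_compl]; omega)
  -- Both base points lie outside `F`; the blocks through them cover everything but `s`, which joins
  -- the exceptional set `E`.
  rw [Finset.mem_compl] at hp hq
  obtain ⟨s, -, -, -, hr⟩ := exists_unique_uncovered_point h h0 (by omega) hmod hcard hpq
  obtain ⟨A, hA, hAF⟩ := exists_block_disjoint
    (ℬ := 𝒞.filter fun A => A.card = 5 ∧ p ∈ A ∧ q ∈ A)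
    (P := {p, q}) (E := {p, q, s}) (F := F) (k := 3) (by simp [hp, hq])
    (by
      intro A hA
      simp only [Finset.mem_filter] at hA
      have hsub : {p, q} ⊆ A := by simp [Finset.insert_subset_iff, hA.2.2.1, hA.2.2.2]
      refine ⟨hsub, ?_⟩
      rw [Finset.card_sdiff_of_subset hsub, hA.2.1, Finset.card_pair hpq])
    (by
      intro A hA B hB r hr hrA hrB
      simp only [Finset.mem_insert, Finset.mem_singleton, not_or] at hr
      simp only [Finset.mem_filter] at hA hB
      refine h.eq_of_card_inter hA.1 hB.1 (S := {p, q, r}) ?_ ?_ ?_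
      · simp [Finset.insert_subset_iff, hA.2.2, hrA]
      · simp [Finset.insert_subset_iff, hB.2.2, hrB]
      · rw [Finset.card_eq_three.mpr ⟨p, q, r, hpq, Ne.symm hr.1, Ne.symm hr.2, rfl⟩]; omega)
    (by
      intro r hrE
      simp only [Finset.mem_insert, Finset.mem_singleton, not_or] at hrE
      obtain ⟨A, hA, h5, hpA, hqA, hrA⟩ := hr r hrE.1 hrE.2.1 hrE.2.2
      exact ⟨A, by simp [hA, h5, hpA, hqA], hrA⟩)
    (by simp [Finset.insert_subset_iff])
    (by have := Finset.card_le_three (a := p) (b := q) (c := s); omega)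
  simp only [Finset.mem_filter] at hA
  exact ⟨A, hA.1, hA.2.1, hAF⟩

end NearlyPerfect

/-! ### Comparing the two operations on light codewords -/

/-- If through every coordinate there is a light codeword avoiding any prescribed small set, then
two structures under which the code is closed agree wherever the first one moves a coordinate. -/
theorem apply_eq_of_light_words {n : ℕ} {C : Set (BinWord n)} (hd : HasMinDist C 3) (w : ℕ)
    (hlight : ∀ (i : Fin n) (F : Finset (Fin n)), i ∉ F → F.card ≤ 3 * w + 1 →
      ∃ y ∈ C, y i ≠ 0 ∧ (∀ u ∈ F, y u = 0) ∧ (Finset.univ.filter fun u => y u ≠ 0).card ≤ w + 1)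
    {π τ : Equiv.Perm (Fin n)} (hπ : IsZ2Z4Structure π) (hτ : IsZ2Z4Structure τ)
    (hCπ : ClosedUnderStar π C) (hCτ : ClosedUnderStar τ C) (i : Fin n) (hi : π i ≠ i) :
    π i = τ i := by
  classical
  by_contra hne
  have hπinv : ∀ u, π⁻¹ u = π u := fun u => by rw [Equiv.Perm.inv_eq_iff_eq, hπ u]
  have hτinv : ∀ u, τ⁻¹ u = τ u := fun u => by rw [Equiv.Perm.inv_eq_iff_eq, hτ u]
  have h2 : ∀ a b : ZMod 2, a + b ≠ 0 → a ≠ 0 ∨ b ≠ 0 := by decide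
  obtain ⟨x, hxC, hxi, hxF, hxw⟩ := hlight i {π i} (by simpa using hi.symm) (by simp)
  have hxj : x (π i) = 0 := hxF _ (by simp)
  let X : Finset (Fin n) := (Finset.univ.filter fun u => x u ≠ 0).erase i
  have hX : X.card ≤ w := by
    rw [Finset.card_erase_of_mem (by simpa using hxi)]; omega
  -- Three points for each of the at most `w` points of `X`, plus `π i`, give `3 * w + 1`. Erasing
  -- `i` matters: `τ a = i` is possible for some `a` in `X`.
  let F : Finset (Fin n) := (insert (π i) (X.biUnion fun a => {a, π a, τ a})).erase i
  have hF : F.card ≤ 3 * w + 1 := by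
    have h1 := Finset.card_biUnion_le_card_mul X (fun a => ({a, π a, τ a} : Finset (Fin n))) 3
      (fun a _ => Finset.card_le_three)
    have h3 := Finset.card_erase_le (a := i)
      (s := insert (π i) (X.biUnion fun a => {a, π a, τ a}))
    have h4 := Finset.card_insert_le (π i) (X.biUnion fun a => {a, π a, τ a})
    show Finset.card (Finset.erase _ _) ≤ _
    omega
  obtain ⟨y, hyC, hyi, hyF, -⟩ := hlight i F (by simp [F]) hF
  have hyj : y (π i) = 0 := hyF _ (by simp [F, hi])
  have hy : ∀ a v, x a ≠ 0 → a ≠ i → y v ≠ 0 → (v = a ∨ v = π a ∨ v = τ a) → v = i := by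
    intro a v ha hai hv hva
    by_contra hvi
    refine hv (hyF v ?_)
    simp only [F, X, Finset.mem_erase, Finset.mem_insert, Finset.mem_biUnion,
      Finset.mem_filter, Finset.mem_univ, true_and, Finset.mem_singleton]
    exact ⟨hvi, Or.inr ⟨a, ⟨hai, ha⟩, hva⟩⟩
  have hsπ : ∀ u, starOp π x y u = x u + y u + (x u + x (π u)) * (y u + y (π u)) := fun u => by
    simp [starOp, permWord, hπinv]
  have hsτ : ∀ u, starOp τ x y u = x u + y u + (x u + x (τ u)) * (y u + y (τ u)) := fun u => by
    simp [starOp, permWord, hτinv]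
  -- A nonzero product requires the orbit `{u, π u}` to meet both supports; by the choice of `y`
  -- such an orbit contains `i`.
  have hTπ : ∀ u, (x u + x (π u)) * (y u + y (π u)) ≠ 0 → u = i ∨ u = π i := by
    intro u hu
    obtain ⟨a, hau, ha⟩ : ∃ a, (a = u ∨ a = π u) ∧ x a ≠ 0 := by
      rcases h2 _ _ (left_ne_zero_of_mul hu) with h | h
      exacts [⟨_, Or.inl rfl, h⟩, ⟨_, Or.inr rfl, h⟩]
    obtain ⟨v, hvu, hv⟩ : ∃ v, (v = u ∨ v = π u) ∧ y v ≠ 0 := by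
      rcases h2 _ _ (right_ne_zero_of_mul hu) with h | h
      exacts [⟨_, Or.inl rfl, h⟩, ⟨_, Or.inr rfl, h⟩]
    by_cases hai : a = i
    · rcases hau with h | h
      · left; rw [← h, hai]
      · right; rw [← hai, h, hπ u]
    · have hva : v = a ∨ v = π a := by
        rcases hau with rfl | rfl <;> rcases hvu with rfl | rfl <;> simp [hπ _]
      have hvi := hy a v ha hai hv (by tauto)
      rcases hvu with h | h
      · left; rw [← h, hvi]
      · right; rw [← hvi, h, hπ u]
  have hTτ : ∀ u, (x u + x (τ u)) * (y u + y (τ u)) ≠ 0 → u = i ∨ u = τ i := by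
    intro u hu
    obtain ⟨a, hau, ha⟩ : ∃ a, (a = u ∨ a = τ u) ∧ x a ≠ 0 := by
      rcases h2 _ _ (left_ne_zero_of_mul hu) with h | h
      exacts [⟨_, Or.inl rfl, h⟩, ⟨_, Or.inr rfl, h⟩]
    obtain ⟨v, hvu, hv⟩ : ∃ v, (v = u ∨ v = τ u) ∧ y v ≠ 0 := by
      rcases h2 _ _ (right_ne_zero_of_mul hu) with h | h
      exacts [⟨_, Or.inl rfl, h⟩, ⟨_, Or.inr rfl, h⟩]
    by_cases hai : a = i
    · rcases hau with h | h
      · left; rw [← h, hai]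
      · right; rw [← hai, h, hτ u]
    · have hva : v = a ∨ v = τ a := by
        rcases hau with rfl | rfl <;> rcases hvu with rfl | rfl <;> simp [hτ _]
      have hvi := hy a v ha hai hv (by tauto)
      rcases hvu with h | h
      · left; rw [← h, hvi]
      · right; rw [← hvi, h, hτ u]
  have hone : ∀ a b : ZMod 2, a ≠ 0 → b ≠ 0 → a * b = 1 := by decide
  have hTi : (x i + x (π i)) * (y i + y (π i)) = 1 := by
    rw [hxj, hyj, add_zero, add_zero]; exact hone _ _ hxi hyi
  have hTj : (x (π i) + x (π (π i))) * (y (π i) + y (π (π i))) = 1 := by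
    rw [hπ i, hxj, hyj, zero_add, zero_add]; exact hone _ _ hxi hyi
  have hTτj : (x (π i) + x (τ (π i))) * (y (π i) + y (τ (π i))) = 0 := by
    by_contra h
    rcases hTτ _ h with h | h
    exacts [hi h, hne h]
  have hdiff : starOp π x y ≠ starOp τ x y := by
    intro h
    have := congrFun h (π i)
    rw [hsπ, hsτ, hTj, hTτj] at this
    simp at this
  have hdist := hd _ (hCπ x hxC y hyC) _ (hCτ x hxC y hyC) hdiff
  -- If the `τ` term vanishes at `i`, it vanishes everywhere and the results differ only within `{π
  -- i, i}`. Otherwise both terms are 1 at `i`, which cancels and leaves `{π i, τ i}`.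
  obtain ⟨k, hk⟩ : ∃ k, ∀ u, starOp π x y u ≠ starOp τ x y u → u = π i ∨ u = k := by
    by_cases hτi : (x i + x (τ i)) * (y i + y (τ i)) = 0
    · refine ⟨i, fun u hu => ?_⟩
      by_contra! hcon
      refine hu ?_
      rw [hsπ, hsτ]
      have h1 : (x u + x (π u)) * (y u + y (π u)) = 0 := by
        by_contra h; rcases hTπ u h with h | h
        exacts [hcon.2 h, hcon.1 h]
      have h3 : (x u + x (τ u)) * (y u + y (τ u)) = 0 := by
        by_contra h; rcases hTτ u h with h' | h'
        · exact hcon.2 h'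
        · rw [h', hτ i, add_comm (x _), add_comm (y _)] at h; exact h hτi
      rw [h1, h3]
    · refine ⟨τ i, fun u hu => ?_⟩
      by_contra! hcon
      refine hu ?_
      rw [hsπ, hsτ]
      by_cases hui : u = i
      · rw [hui, hTi, hone _ _ (left_ne_zero_of_mul hτi) (right_ne_zero_of_mul hτi)]
      have h1 : (x u + x (π u)) * (y u + y (π u)) = 0 := by
        by_contra h; rcases hTπ u h with h | h
        exacts [hui h, hcon.1 h]
      have h3 : (x u + x (τ u)) * (y u + y (τ u)) = 0 := by
        by_contra h; rcases hTτ u h with h | h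
        exacts [hui h, hcon.2 h]
      rw [h1, h3]
  have hle : hammingDist (starOp π x y) (starOp τ x y) ≤ ({π i, k} : Finset (Fin n)).card := by
    refine Finset.card_le_card fun u hu => ?_
    simpa using hk u (by simpa using hu)
  have := Finset.card_le_two (a := π i) (b := k)
  omega

/-- A coordinate fixed by `π` but moved by `τ` is handled by exchanging the roles of the two
structures. -/
theorem eq_of_light_words {n : ℕ} {C : Set (BinWord n)} (hd : HasMinDist C 3) (w : ℕ)
    (hlight : ∀ (i : Fin n) (F : Finset (Fin n)), i ∉ F → F.card ≤ 3 * w + 1 →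
      ∃ y ∈ C, y i ≠ 0 ∧ (∀ u ∈ F, y u = 0) ∧ (Finset.univ.filter fun u => y u ≠ 0).card ≤ w + 1)
    {π τ : Equiv.Perm (Fin n)} (hπ : IsZ2Z4Structure π) (hτ : IsZ2Z4Structure τ)
    (hCπ : ClosedUnderStar π C) (hCτ : ClosedUnderStar τ C) : π = τ := by
  ext1 i
  by_cases hi : π i = i
  · by_cases hi' : τ i = i
    · rw [hi, hi']
    · exact (apply_eq_of_light_words hd w hlight hτ hπ hCτ hCπ i hi').symm
  · exact apply_eq_of_light_words hd w hlight hπ hτ hCπ hCτ i hi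

/-- Under `*_π` each fixed coordinate is a copy of Z₂ and each swapped pair a copy of Z₄ through the
Gray map, so `(x * x) * (x * x) = 0`. -/
theorem zero_mem_of_closedUnderStar {n : ℕ} {C : Set (BinWord n)} (hC : C.Nonempty)
    {π : Equiv.Perm (Fin n)} (hπ : IsZ2Z4Structure π) (hCπ : ClosedUnderStar π C) :
    (0 : BinWord n) ∈ C := by
  obtain ⟨x, hx⟩ := hC
  have h1 := hCπ _ (hCπ x hx x hx) _ (hCπ x hx x hx)
  have hπinv : ∀ u, π⁻¹ u = π u := fun u => by rw [Equiv.Perm.inv_eq_iff_eq, hπ u]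
  convert h1 using 1
  ext1 u
  have key : ∀ a b : ZMod 2, 0 = (a + a + (a + b) * (a + b)) + (a + a + (a + b) * (a + b)) +
    ((a + a + (a + b) * (a + b)) + (b + b + (b + a) * (b + a))) *
    ((a + a + (a + b) * (a + b)) + (b + b + (b + a) * (b + a))) := by decide
  simpa [starOp, permWord, hπinv, hπ u] using key (x u) (x (π u))

/-! ### From binary words to supports, puncturing, and light words in the three families -/

section Conversion

variable {n : ℕ}

/-- The set of coordinates where a binary word is nonzero. -/
def wordSupport (x : BinWord n) : Finset (Fin n) := Finset.univ.filter fun u => x u ≠ 0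

/-- The support of a word with the coordinate `i` deleted. -/
def puncturedSupport (i : Fin n) (x : BinWord n) : Finset {u : Fin n // u ≠ i} :=
  (wordSupport x).subtype fun u => u ≠ i

theorem mem_wordSupport {x : BinWord n} {u : Fin n} : u ∈ wordSupport x ↔ x u ≠ 0 := by
  simp [wordSupport]

theorem wordSupport_zero : wordSupport (0 : BinWord n) = ∅ := by
  simp [wordSupport]

theorem puncturedSupport_zero (i : Fin n) : puncturedSupport i (0 : BinWord n) = ∅ := by
  ext u
  simp [puncturedSupport, wordSupport_zero]

theorem hammingDist_eq_card_symmDiff (x y : BinWord n) :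
    hammingDist x y = (wordSupport x ∆ wordSupport y).card := by
  unfold hammingDist
  congr 1
  ext u
  have : ∀ a b : ZMod 2, a ≠ b ↔ (a ≠ 0 ∧ ¬ b ≠ 0 ∨ b ≠ 0 ∧ ¬ a ≠ 0) := by decide
  simp only [Finset.mem_filter, Finset.mem_univ, true_and, Finset.mem_symmDiff, mem_wordSupport]
  exact this _ _

theorem puncturedSupport_symmDiff (i : Fin n) (x y : BinWord n) :
    puncturedSupport i x ∆ puncturedSupport i y =
      (wordSupport x ∆ wordSupport y).subtype fun u => u ≠ i := by
  ext u
  simp [puncturedSupport, Finset.mem_symmDiff]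

theorem hammingDist_le_card_punctured (i : Fin n) (x y : BinWord n) :
    hammingDist x y ≤ (puncturedSupport i x ∆ puncturedSupport i y).card + 1 := by
  rw [hammingDist_eq_card_symmDiff, puncturedSupport_symmDiff, Finset.card_subtype,
    Finset.filter_ne']
  have := Finset.pred_card_le_card_erase (a := i) (s := wordSupport x ∆ wordSupport y)
  omega

theorem setMinDist_wordSupport {C : Finset (BinWord n)} {d : ℕ}
    (hC : HasMinDist (C : Set (BinWord n)) d) : SetMinDist (C.image wordSupport) d := by
  intro A hA B hB hAB
  obtain ⟨x, hx, rfl⟩ := Finset.mem_image.mp hA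
  obtain ⟨y, hy, rfl⟩ := Finset.mem_image.mp hB
  rw [← hammingDist_eq_card_symmDiff]
  exact hC x hx y hy (by rintro rfl; exact hAB rfl)

theorem setMinDist_puncturedSupport {C : Finset (BinWord n)} {d : ℕ}
    (hC : HasMinDist (C : Set (BinWord n)) (d + 1)) (i : Fin n) :
    SetMinDist (C.image (puncturedSupport i)) d := by
  intro A hA B hB hAB
  obtain ⟨x, hx, rfl⟩ := Finset.mem_image.mp hA
  obtain ⟨y, hy, rfl⟩ := Finset.mem_image.mp hB
  have h1 := hC x hx y hy (by rintro rfl; exact hAB rfl)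
  have h2 := hammingDist_le_card_punctured i x y
  omega

theorem card_image_wordSupport {C : Finset (BinWord n)} {d : ℕ}
    (hC : HasMinDist (C : Set (BinWord n)) (d + 1)) :
    (C.image wordSupport).card = C.card := by
  refine Finset.card_image_of_injOn fun x hx y hy hxy => ?_
  by_contra hne
  have h1 := hC x hx y hy hne
  rw [hammingDist_eq_card_symmDiff, hxy, symmDiff_self] at h1
  simp at h1

theorem card_image_puncturedSupport {C : Finset (BinWord n)} {d : ℕ}
    (hC : HasMinDist (C : Set (BinWord n)) (d + 2)) (i : Fin n) :
    (C.image (puncturedSupport i)).card = C.card := by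
  refine Finset.card_image_of_injOn fun x hx y hy hxy => ?_
  by_contra hne
  have h1 := hC x hx y hy hne
  have h2 := hammingDist_le_card_punctured i x y
  rw [hxy, symmDiff_self] at h2
  simp at h2
  omega

theorem card_punctured_index (i : Fin n) : Fintype.card {u : Fin n // u ≠ i} + 1 = n := by
  have h := i.pos
  rw [Fintype.card_subtype_compl, Fintype.card_fin, Fintype.card_subtype_eq]
  omega

/-- A word of weight `d` of the punctured code extends to a codeword of weight at most `d + 1`
that contains the deleted coordinate. -/
theorem exists_light_word_of_punctured {C : Finset (BinWord n)} {d : ℕ}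
    (hC : HasMinDist (C : Set (BinWord n)) (d + 1)) (h0 : 0 ∈ C) (hd : 0 < d) (i : Fin n)
    {F : Finset (Fin n)} {A : Finset {u : Fin n // u ≠ i}}
    (hA : A ∈ C.image (puncturedSupport i)) (hAd : A.card = d) (hiF : i ∉ F)
    (hAF : Disjoint A (F.subtype fun u => u ≠ i)) :
    ∃ y ∈ C, y i ≠ 0 ∧ (∀ u ∈ F, y u = 0) ∧
      (Finset.univ.filter fun u => y u ≠ 0).card ≤ d + 1 := by
  obtain ⟨y, hy, rfl⟩ := Finset.mem_image.mp hA
  have hcard : ((wordSupport y).erase i).card = d := by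
    rw [← hAd, puncturedSupport, Finset.card_subtype, Finset.filter_ne']
  refine ⟨y, hy, fun hyi => ?_, fun u hu => ?_, ?_⟩
  -- If `y i = 0`, puncturing loses nothing and `y` has weight `d`, too close to the zero codeword.
  · rw [Finset.erase_eq_of_notMem (by simpa [mem_wordSupport] using hyi)] at hcard
    have hne : y ≠ 0 := by
      rintro rfl
      rw [wordSupport_zero, Finset.card_empty] at hcard
      omega
    have := hC y hy 0 h0 hne
    rw [hammingDist_eq_card_symmDiff, wordSupport_zero, show (∅ : Finset (Fin n)) = ⊥ from rfl,
      symmDiff_bot] at this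
    omega
  · by_contra hyu
    have hui : u ≠ i := by rintro rfl; exact hiF hu
    have hmem : (⟨u, hui⟩ : {u : Fin n // u ≠ i}) ∈ puncturedSupport i y := by
      simpa [puncturedSupport, mem_wordSupport] using hyu
    exact Finset.disjoint_left.mp hAF hmem (by simpa using hu)
  · have := Finset.pred_card_le_card_erase (a := i) (s := wordSupport y)
    change (wordSupport y).card ≤ _
    omega

theorem light_words_of_onePerfect {C : Finset (BinWord n)} (hn : 16 < n)
    (hC : IsOnePerfect (C : Set (BinWord n))) (h0 : 0 ∈ C) (i : Fin n) (F : Finset (Fin n))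
    (hiF : i ∉ F) (hF : F.card ≤ 3 * 2 + 1) :
    ∃ y ∈ C, y i ≠ 0 ∧ (∀ u ∈ F, y u = 0) ∧
      (Finset.univ.filter fun u => y u ≠ 0).card ≤ 2 + 1 := by
  obtain ⟨hcard, hdist⟩ := hC
  rw [Set.ncard_coe_finset, ← card_image_wordSupport (d := 2) hdist] at hcard
  obtain ⟨A, hA, hA3, hiA, hAF⟩ := exists_triple_disjoint_of_perfect
    (setMinDist_wordSupport hdist) (Finset.mem_image.mpr ⟨0, h0, wordSupport_zero⟩)
    (by simpa using hcard) hiF (by rw [Fintype.card_fin]; omega)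
  obtain ⟨y, hy, rfl⟩ := Finset.mem_image.mp hA
  refine ⟨y, hy, mem_wordSupport.mp hiA, fun u hu => ?_, hA3.le⟩
  by_contra hyu
  exact Finset.disjoint_left.mp hAF (mem_wordSupport.mpr hyu) hu

theorem exists_pow_two_of_dvd {m k : ℕ} (h : m ∣ 2 ^ k) (hm : 16 < m) :
    ∃ a, m = 2 ^ (a + 5) := by
  obtain ⟨a, -, rfl⟩ := (Nat.dvd_prime_pow Nat.prime_two).mp h
  have h4 : 4 < a := (Nat.pow_lt_pow_iff_right (a := 2) (by norm_num)).mp (by simpa using hm)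
  exact ⟨a - 5, by rw [Nat.sub_add_cancel h4]⟩

theorem light_words_of_extendedOnePerfect {C : Finset (BinWord n)} (hn : 16 < n)
    (hC : IsExtendedOnePerfect (C : Set (BinWord n))) (h0 : 0 ∈ C) (i : Fin n)
    (F : Finset (Fin n)) (hiF : i ∉ F) (hF : F.card ≤ 3 * 3 + 1) :
    ∃ y ∈ C, y i ≠ 0 ∧ (∀ u ∈ F, y u = 0) ∧
      (Finset.univ.filter fun u => y u ≠ 0).card ≤ 3 + 1 := by
  obtain ⟨hcard, hdist⟩ := hC
  obtain ⟨a, ha⟩ := exists_pow_two_of_dvd (m := n) (k := n)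
    (hcard ▸ Dvd.intro_left _ (mul_assoc _ 2 n)) hn
  have hN := card_punctured_index i
  -- The avoidance needs `1 + 10 * 2 < n - 1`; `n > 16` alone is not enough, but `n` is a power of
  -- two.
  have hn32 : 32 ≤ n := by
    rw [ha, pow_add]; have := Nat.one_le_two_pow (n := a); omega
  rw [Set.ncard_coe_finset, ← card_image_puncturedSupport (d := 2) hdist i] at hcard
  have hF' : (F.subtype fun u => u ≠ i).card ≤ F.card := by
    rw [Finset.card_subtype]; exact Finset.card_filter_le _ _
  have hcard' : (C.image (puncturedSupport i)).card * (Fintype.card {u : Fin n // u ≠ i} + 1) =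
      2 ^ Fintype.card {u : Fin n // u ≠ i} := by
    have h2 : 2 ^ n = 2 * 2 ^ Fintype.card {u : Fin n // u ≠ i} := by
      rw [← pow_succ', hN]
    rw [h2] at hcard
    rw [hN]
    nlinarith
  obtain ⟨p, hp⟩ : ∃ p, p ∉ F.subtype fun u => u ≠ i := by
    by_contra! hall
    have := Finset.card_univ (α := {u : Fin n // u ≠ i})
    rw [← Finset.eq_univ_of_forall hall] at this
    omega
  obtain ⟨A, hA, hA3, -, hAF⟩ := exists_triple_disjoint_of_perfect
    (setMinDist_puncturedSupport hdist i)
    (Finset.mem_image.mpr ⟨0, h0, puncturedSupport_zero i⟩) hcard' hp (by omega)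
  exact exists_light_word_of_punctured hdist h0 (by norm_num) i hA hA3 hiF hAF

theorem light_words_of_preparataLike {C : Finset (BinWord n)} (hn : 16 < n)
    (hC : IsPreparataLike (C : Set (BinWord n))) (h0 : 0 ∈ C) (i : Fin n)
    (F : Finset (Fin n)) (hiF : i ∉ F) (hF : F.card ≤ 3 * 5 + 1) :
    ∃ y ∈ C, y i ≠ 0 ∧ (∀ u ∈ F, y u = 0) ∧
      (Finset.univ.filter fun u => y u ≠ 0).card ≤ 5 + 1 := by
  obtain ⟨hcard, hdist⟩ := hC
  obtain ⟨a, ha⟩ := exists_pow_two_of_dvd (m := n) (k := n)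
    ((dvd_pow_self n two_ne_zero).trans (hcard ▸ Dvd.intro_left _ rfl)) hn
  have hN := card_punctured_index i
  rw [Set.ncard_coe_finset, ← card_image_puncturedSupport (d := 4) hdist i] at hcard
  have hcard' : (C.image (puncturedSupport i)).card *
      (Fintype.card {u : Fin n // u ≠ i} + 1) ^ 2 =
      2 ^ (Fintype.card {u : Fin n // u ≠ i} + 1) := by rwa [hN]
  have hF' : (F.subtype fun u => u ≠ i).card ≤ F.card := by
    rw [Finset.card_subtype]; exact Finset.card_filter_le _ _
  have hmod : Fintype.card {u : Fin n // u ≠ i} % 3 ≠ 2 := by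
    intro h
    have h3 : 3 ∣ 2 ^ (a + 5) := by rw [← ha]; omega
    have := Nat.prime_three.dvd_of_dvd_pow h3
    omega
  have hmin := setMinDist_puncturedSupport hdist i
  have hmem := Finset.mem_image.mpr ⟨0, h0, puncturedSupport_zero i⟩
  -- Now 3 divides `n - 1`, which excludes `n = 32`. The next power of two suffices, as `3 + 16 * 3
  -- < 63`.
  have h3 := card_mod_three_of_nearly_perfect hmin hmem (by omega) hmod hcard'
  have hn64 : 64 ≤ n := by
    rcases a with _ | a
    · omega
    · rw [ha, show a + 1 + 5 = a + 6 by ring, pow_add]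
      have := Nat.one_le_two_pow (n := a)
      omega
  obtain ⟨A, hA, hA5, hAF⟩ := exists_quintuple_disjoint_of_nearly_perfect
    (F := F.subtype fun u => u ≠ i) hmin hmem hmod hcard' (by omega)
  exact exists_light_word_of_punctured hdist h0 (by norm_num) i hA hA5 hiF hAF

end Conversion

/-! ### Conclusion for the three families -/

theorem HasMinDist.mono {n : ℕ} {C : Set (BinWord n)} {d e : ℕ} (h : HasMinDist C d)
    (hed : e ≤ d) : HasMinDist C e :=
  fun x hx y hy hxy => hed.trans (h x hx y hy hxy)

theorem theorem1 (n : ℕ) (hn : 16 < n) (C : Set (BinWord n))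
    (hC : IsOnePerfect C ∨ IsExtendedOnePerfect C ∨ IsPreparataLike C)
    (π τ : Equiv.Perm (Fin n)) (hπ : IsZ2Z4Structure π) (hτ : IsZ2Z4Structure τ)
    (hCπ : ClosedUnderStar π C) (hCτ : ClosedUnderStar τ C) :
    π = τ := by
  classical
  have hne : C.Nonempty := by
    rw [← Set.ncard_pos]
    by_contra! h0
    have h0 : C.ncard = 0 := by omega
    have hpos : (0 : ℕ) < 2 ^ n := by positivity
    rcases hC with h | h | h <;>
    · have := h.1
      rw [h0, zero_mul] at this
      omega
  have hzero := zero_mem_of_closedUnderStar hne hπ hCπ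
  lift C to Finset (BinWord n) using C.toFinite
  rw [Finset.mem_coe] at hzero
  rcases hC with h | h | h
  · exact eq_of_light_words h.2 2 (light_words_of_onePerfect hn h hzero) hπ hτ hCπ hCτ
  · exact eq_of_light_words (h.2.mono (by norm_num)) 3
      (light_words_of_extendedOnePerfect hn h hzero) hπ hτ hCπ hCτ
  · exact eq_of_light_words (h.2.mono (by norm_num)) 5
      (light_words_of_preparataLike hn h hzero) hπ hτ hCπ hCτ
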